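/- Let $p,q$ be integers with $1\le p<q$ and let $G=\mathrm{BS}(p,q)=\langle a,b\mid ab^{p}a^{-1}=b^{q}\rangle$. Let $\lambda:G\to\mathbb{Z}$ be the homomorphism with $\lambda(a)=1$, $\lambda(b)=0$, and let $\pi:G\to\mathrm{Aff}^{+}(\mathbb{R})$ be the homomorphism into the group of maps $x\mapsto\alpha x+\beta$ with $\alpha>0$, $\beta\in\mathbb{R}$ (under composition), given by $\pi(a)=(x\mapsto\frac{q}{p}x)$ and $\pi(b)=(x\mapsto x+1)$. Let $\mathbb{H}=\{z\in\mathbb{C}:\Im z>0\}$ with the hyperbolic metric $d_{\mathbb{H}}$. Applying the same formula $z\mapsto\alpha z+\beta$ to points of $\mathbb{H}$, put $\pi_{\mathbb{H}}(g)=\pi(g)(i)\in\mathbb{H}$, $A_g=\Im\pi_{\mathbb{H}}(g)$ and $B_g=\Re\pi_{\mathbb{H}}(g)$ for $g\in G$. Let $\mu$ be a probability measure on $G$ whose support generates $G$ as a semigroup, and let $Z=(Z_0,Z_1,\dots)$ be the random walk on $G$ driven by $\mu$: $Z_0=1$ almost surely, and $Z_n=Z_{n-1}X_n$ for $n\ge1$,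 where the increments $X_1,X_2,\dots$ are independent and $\mu$-distributed. Assume that $\ln(A_{X_1})$ has finite second moment, that there is an $\varepsilon>0$ such that $\ln(1+|B_{X_1}|)$ has finite $(2+\varepsilon)$-th moment, and that the vertical drift $\delta=\mathbb{E}(\lambda(X_1))$ is zero. Then $$\frac{d_{\mathbb{H}}(\pi_{\mathbb{H}}(Z_0),\pi_{\mathbb{H}}(Z_n))}{n}\longrightarrow 0\qquad(n\to\infty)\quad\text{almost surely.}$$ -/

import Mathlib

open MeasureTheory ProbabilityTheory Filter
open scoped Topology UpperHalfPlane

noncomputable section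

namespace BaumslagSolitar

/-! ### The groups `BS(p,q)` -/

/-- The two standard generators. -/
inductive Gen : Type
  | a : Gen
  | b : Gen

/-- The single relator `a b^p a⁻¹ b^(-q)`. -/
def relators (p q : ℤ) : Set (FreeGroup Gen) :=
  {FreeGroup.of Gen.a * FreeGroup.of Gen.b ^ p * (FreeGroup.of Gen.a)⁻¹ *
    (FreeGroup.of Gen.b ^ q)⁻¹}

/-- The Baumslag--Solitar group `⟨a, b ∣ a b^p a⁻¹ = b^q⟩`. -/
def BS (p q : ℤ) : Type := PresentedGroup (relators p q)

instance (p q : ℤ) : Group (BS p q) := inferInstanceAs (Group (PresentedGroup (relators p q)))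

/-- `BS(p,q)` is a discrete space: every subset is measurable. -/
instance (p q : ℤ) : MeasurableSpace (BS p q) := ⊤

instance (p q : ℤ) : DiscreteMeasurableSpace (BS p q) := ⟨fun _ => trivial⟩

/-- Von Dyck's theorem for `BS(p,q)`: elements `x, y` of a group `H` with
`x y^p x⁻¹ = y^q` determine the homomorphism with `a ↦ x` and `b ↦ y`. -/
def lift {H : Type*} [Group H] {p q : ℤ} (x y : H) (h : x * y ^ p * x⁻¹ = y ^ q) :
    BS p q →* H :=
  PresentedGroup.toGroup (rels := relators p q) (f := fun g : Gen => Gen.casesOn g x y) (by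
    intro r hr
    rw [relators, Set.mem_singleton_iff] at hr
    subst hr
    simp [h])

/-- The level homomorphism `BS(p,q) → ℤ`, with `a ↦ 1` and `b ↦ 0`. -/
def levelHom (p q : ℤ) : BS p q →* Multiplicative ℤ :=
  lift (Multiplicative.ofAdd 1) 1 (by simp)

/-- The level of a group element, as an integer. -/
def level {p q : ℤ} (g : BS p q) : ℤ := Multiplicative.toAdd (levelHom p q g)

/-! ### Orientation preserving affine maps of the line -/

/-- The map `x ↦ scale * x + shift` with `scale > 0`. -/
@[ext]
structure AffPlus where
  scale : ℝ
  shift : ℝ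
  scale_pos : 0 < scale

namespace AffPlus

/-- The group law is composition: `(φ * ψ)(x) = φ (ψ x)`, see `mul_apply` below. -/
instance : Mul AffPlus :=
  ⟨fun φ ψ => ⟨φ.scale * ψ.scale, φ.scale * ψ.shift + φ.shift, mul_pos φ.scale_pos ψ.scale_pos⟩⟩

instance : One AffPlus := ⟨⟨1, 0, one_pos⟩⟩

instance : Inv AffPlus :=
  ⟨fun φ => ⟨φ.scale⁻¹, -(φ.scale⁻¹ * φ.shift), inv_pos.mpr φ.scale_pos⟩⟩

@[simp] lemma mul_scale (φ ψ : AffPlus) : (φ * ψ).scale = φ.scale * ψ.scale := rfl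
@[simp] lemma mul_shift (φ ψ : AffPlus) :
    (φ * ψ).shift = φ.scale * ψ.shift + φ.shift := rfl
@[simp] lemma one_scale : (1 : AffPlus).scale = 1 := rfl
@[simp] lemma one_shift : (1 : AffPlus).shift = 0 := rfl
@[simp] lemma inv_scale (φ : AffPlus) : φ⁻¹.scale = φ.scale⁻¹ := rfl
@[simp] lemma inv_shift (φ : AffPlus) : φ⁻¹.shift = -(φ.scale⁻¹ * φ.shift) := rfl

instance : Group AffPlus :=
  Group.ofLeftAxioms
    (by intro φ ψ χ; ext <;> simp <;> ring)
    (by intro φ; ext <;> simp)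
    (by intro φ; ext <;> simp [φ.scale_pos.ne'])

/-- The affine map itself. -/
def apply (φ : AffPlus) (x : ℝ) : ℝ := φ.scale * x + φ.shift

lemma mul_apply (φ ψ : AffPlus) (x : ℝ) : (φ * ψ).apply x = φ.apply (ψ.apply x) := by
  simp only [apply, mul_scale, mul_shift]; ring

/-- The same formula `z ↦ scale * z + shift` as a map of the upper half-plane. -/
def onH (φ : AffPlus) (z : ℍ) : ℍ :=
  UpperHalfPlane.mk ((φ.scale : ℂ) * (z : ℂ) + (φ.shift : ℂ)) (by
    simpa using mul_pos φ.scale_pos z.im_pos)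

/-- The dilation `x ↦ r * x`. -/
def dilation (r : ℝ) (hr : 0 < r) : AffPlus := ⟨r, 0, hr⟩

/-- The translation `x ↦ x + t`. -/
def translation (t : ℝ) : AffPlus := ⟨1, t, one_pos⟩

lemma translation_one_zpow (n : ℤ) : translation 1 ^ n = translation n := by
  have hadd : ∀ s t : ℝ, translation s * translation t = translation (s + t) := by
    intro s t; ext <;> simp [translation, add_comm]
  have hnat : ∀ m : ℕ, translation 1 ^ m = translation m := by
    intro m
    induction m with
    | zero => ext <;> simp [translation]
    | succ m ih => rw [pow_succ, ih, hadd]; push_cast; rfl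
  cases n with
  | ofNat m => simpa using hnat m
  | negSucc m =>
    rw [zpow_negSucc, hnat, inv_eq_iff_mul_eq_one, hadd]
    ext <;> simp [translation, Int.negSucc_eq]

end AffPlus

lemma ratio_pos {p q : ℤ} (hp : 1 ≤ p) (hpq : p < q) : 0 < (q : ℝ) / (p : ℝ) :=
  div_pos (by exact_mod_cast (by omega : 0 < q)) (by exact_mod_cast (by omega : 0 < p))

/-- The homomorphism `BS(p,q) → Aff⁺(ℝ)` with `a ↦ (x ↦ (q/p) x)` and `b ↦ (x ↦ x + 1)`. -/
def projAff {p q : ℤ} (hp : 1 ≤ p) (hpq : p < q) : BS p q →* AffPlus :=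
  lift (AffPlus.dilation ((q : ℝ) / p) (ratio_pos hp hpq)) (AffPlus.translation 1) (by
    have hp0 : (p : ℝ) ≠ 0 := by exact_mod_cast (by omega : p ≠ 0)
    have hq0 : (q : ℝ) ≠ 0 := by exact_mod_cast (by omega : q ≠ 0)
    rw [AffPlus.translation_one_zpow, AffPlus.translation_one_zpow]
    ext <;> simp [AffPlus.dilation, AffPlus.translation] <;> field_simp)

/-- The projection `BS(p,q) → ℍ`, `g ↦ π(g)(i)` with `π = projAff`. -/
def projH {p q : ℤ} (hp : 1 ≤ p) (hpq : p < q) (g : BS p q) : ℍ :=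
  (projAff hp hpq g).onH UpperHalfPlane.I

/-- `A_g`, the imaginary part of the projection to the hyperbolic plane. -/
def imPart {p q : ℤ} (hp : 1 ≤ p) (hpq : p < q) (g : BS p q) : ℝ := (projH hp hpq g).im

/-- `B_g`, the real part of the projection to the hyperbolic plane. -/
def rePart {p q : ℤ} (hp : 1 ≤ p) (hpq : p < q) (g : BS p q) : ℝ := (projH hp hpq g).re

/-! ### Random walks -/

/-- The increments of a process: `increment Z n = Z_n⁻¹ Z_{n+1}`, which is `X_{n+1}` if
`Z_n = X_1 ⋯ X_n`. -/
def increment {Ω G : Type*} [Group G] (Z : ℕ → Ω → G) (n : ℕ) (ω : Ω) : G :=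
  (Z n ω)⁻¹ * Z (n + 1) ω

/-- `Z` is a random walk driven by `μ`: it starts at `1` and has independent `μ`-distributed
increments, which are multiplied from the right. The support of `μ` generates the group as a
semigroup. -/
structure IsRandomWalk {Ω G : Type*} [MeasurableSpace Ω] [Group G] [MeasurableSpace G]
    (P : Measure Ω) (μ : PMF G) (Z : ℕ → Ω → G) : Prop where
  generates : Subsemigroup.closure μ.support = ⊤
  measurable : ∀ n, Measurable (Z n)
  start : ∀ᵐ ω ∂P, Z 0 ω = 1
  indep : iIndepFun (increment Z) P
  law : ∀ n, P.map (increment Z n) = μ.toMeasure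

/-- The real random variable `Y` has finite `k`-th moment. -/
def HasFiniteMoment {Ω : Type*} [MeasurableSpace Ω] (P : Measure Ω) (Y : Ω → ℝ) (k : ℝ) : Prop :=
  Integrable (fun ω => |Y ω| ^ k) P

/-- The vertical drift `𝔼(level X_1)`. -/
def verticalDrift {Ω : Type*} [MeasurableSpace Ω] {p q : ℤ} (P : Measure Ω)
    (Z : ℕ → Ω → BS p q) : ℝ :=
  ∫ ω, (level (increment Z 0 ω) : ℝ) ∂P

end BaumslagSolitar

end

namespace BaumslagSolitar

/-! The distance from `i` to `z` is at most `|log (Im z)| + 2 log (1 + |Re z|)` (`dist_I_le`), so it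
suffices that both terms are `o(n)` along the walk. Since `log A` is additive and equals `level`
times `log (q/p)`, zero drift makes it a centred sum of i.i.d. variables, and the strong law gives
`log A_{Z_n} = o(n)`. For the real part, `B_{Z_{n+1}} = B_{Z_n} + A_{Z_n} B_{X_{n+1}}`, so `|B|`
grows in one step by at most `exp (log A_{Z_n} + log (1 + |B_{X_{n+1}}|))`. The exponent is `o(n)`:
its second summand is a term of a sequence with convergent averages. A sum of `n` terms of size
`e^{o(n)}` is again `e^{o(n)}`. -/

/-- A sequence `u ≥ 1` whose increments grow subexponentially grows subexponentially. -/
lemma tendsto_log_div_of_le_add_exp {u a : ℕ → ℝ} (hu : ∀ n, 1 ≤ u n)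
    (hstep : ∀ n, u (n + 1) ≤ u n + Real.exp (a n))
    (ha : Tendsto (fun n : ℕ => a n / n) atTop (𝓝 0)) :
    Tendsto (fun n : ℕ => Real.log (u n) / n) atTop (𝓝 0) := by
  refine tendsto_order.2 ⟨fun c hc => Eventually.of_forall fun n =>
    hc.trans_le (div_nonneg (Real.log_nonneg (hu n)) n.cast_nonneg), fun c hc => ?_⟩
  -- One third each for the initial value `u N`, the number of summands `n`, and the exponential
  -- rate.
  have hc3 : 0 < c / 3 := by positivity
  obtain ⟨N, hN⟩ := eventually_atTop.1
    (((tendsto_order.1 ha).2 _ hc3).and (eventually_ge_atTop 1))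
  have hN1 : 1 ≤ N := (hN N le_rfl).2
  have bound : ∀ n ≥ N, u n ≤ u N * n * Real.exp (c / 3 * n) := by
    intro n hn
    induction n, hn using Nat.le_induction with
    | base =>
      have h1 : (1 : ℝ) ≤ N := by exact_mod_cast hN1
      have h2 : 1 ≤ Real.exp (c / 3 * N) := Real.one_le_exp (by positivity)
      calc u N = u N * 1 * 1 := by ring
        _ ≤ _ := by have := hu N; gcongr
    | succ n hn ih =>
      have hn0 : (0 : ℝ) < n := by exact_mod_cast (hN n hn).2
      have han : a n ≤ c / 3 * n := ((div_lt_iff₀ hn0).1 (hN n hn).1).le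
      have huN := hu N
      calc u (n + 1) ≤ u N * n * Real.exp (c / 3 * n) + 1 * Real.exp (c / 3 * n) :=
            (hstep n).trans (add_le_add ih (by simpa using han))
        _ ≤ u N * n * Real.exp (c / 3 * n) + u N * Real.exp (c / 3 * n) := by gcongr
        _ = u N * (n + 1) * Real.exp (c / 3 * n) := by ring
        _ ≤ u N * ((n + 1 : ℕ) : ℝ) * Real.exp (c / 3 * ((n + 1 : ℕ) : ℝ)) := by
          push_cast
          gcongr
          linarith
  have hconst : Tendsto (fun n : ℕ => Real.log (u N) / n) atTop (𝓝 0) :=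
    tendsto_const_div_atTop_nhds_zero_nat _
  have hlog : Tendsto (fun n : ℕ => Real.log n / n) atTop (𝓝 0) :=
    (Real.isLittleO_log_id_atTop.tendsto_div_nhds_zero).comp tendsto_natCast_atTop_atTop
  filter_upwards [(tendsto_order.1 hconst).2 _ hc3, (tendsto_order.1 hlog).2 _ hc3,
    eventually_ge_atTop N] with n h1 h2 hn
  have hn0 : (0 : ℝ) < n := by exact_mod_cast hN1.trans hn
  have huN : 0 < u N := one_pos.trans_le (hu N)
  have hle : Real.log (u n) ≤ Real.log (u N) + Real.log n + c / 3 * n := by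
    refine (Real.log_le_log (one_pos.trans_le (hu n)) (bound n hn)).trans_eq ?_
    rw [Real.log_mul (by positivity) (by positivity), Real.log_mul huN.ne' hn0.ne', Real.log_exp]
  have hdiv := div_le_div_of_nonneg_right hle hn0.le
  rw [add_div, add_div, mul_div_cancel_right₀ _ hn0.ne'] at hdiv
  linarith

/-- If the averages of a sequence converge, its terms are sublinear. -/
lemma tendsto_div_of_tendsto_sum_div {f : ℕ → ℝ} {c : ℝ}
    (h : Tendsto (fun n : ℕ => (∑ i ∈ Finset.range n, f i) / n) atTop (𝓝 c)) :
    Tendsto (fun n : ℕ => f n / n) atTop (𝓝 0) := by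
  have hratio : Tendsto (fun n : ℕ => ((n : ℝ) + 1) / n) atTop (𝓝 1) := by
    have : Tendsto (fun n : ℕ => 1 + 1 / (n : ℝ)) atTop (𝓝 (1 + 0)) :=
      tendsto_const_nhds.add (tendsto_const_div_atTop_nhds_zero_nat 1)
    rw [add_zero] at this
    refine this.congr' ?_
    filter_upwards [eventually_gt_atTop 0] with n hn
    have hn0 : (n : ℝ) ≠ 0 := by exact_mod_cast hn.ne'
    field_simp
  -- With `S n` the partial sums, `f n / n = (S (n+1) / (n+1)) * ((n+1) / n) - S n / n`.
  have hdiff := (((tendsto_add_atTop_iff_nat 1).2 h).mul hratio).sub h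
  rw [mul_one, sub_self] at hdiff
  refine hdiff.congr fun n => ?_
  have hn1 : (n : ℝ) + 1 ≠ 0 := by positivity
  rw [Finset.sum_range_succ]
  push_cast
  rw [div_mul_div_comm, mul_comm ((n : ℝ) + 1) n, mul_div_mul_right _ _ hn1, ← sub_div]
  congr 1
  ring

lemma two_mul_arsinh_half_le {x : ℝ} (hx : 0 ≤ x) :
    2 * Real.arsinh (x / 2) ≤ 2 * Real.log (1 + x) := by
  have hsqrt : √(1 + (x / 2) ^ 2) ≤ 1 + x / 2 := by
    rw [Real.sqrt_le_left (by positivity)]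
    nlinarith
  have hpos : 0 < x / 2 + √(1 + (x / 2) ^ 2) := by positivity
  rw [Real.arsinh]
  exact mul_le_mul_of_nonneg_left (Real.log_le_log hpos (by linarith)) zero_le_two

/-- Triangle inequality through `w = Re z + i`: a horizontal move at height 1, then a vertical
geodesic. -/
lemma dist_I_le (z : ℍ) :
    dist UpperHalfPlane.I z ≤ |Real.log z.im| + 2 * Real.log (1 + |z.re|) := by
  let w : ℍ := UpperHalfPlane.mk ((z.re : ℂ) + Complex.I) (by simp)
  have hwre : w.re = z.re := by simp [w]
  have hwim : w.im = 1 := by simp [w]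
  have h1 : dist UpperHalfPlane.I w ≤ 2 * Real.log (1 + |z.re|) := by
    refine le_trans (le_of_eq ?_) (two_mul_arsinh_half_le (abs_nonneg z.re))
    have hd : dist (UpperHalfPlane.I : ℂ) w = |z.re| := by
      rw [dist_comm, Complex.dist_eq]
      simp [w]
    rw [UpperHalfPlane.dist_eq, hd, hwim]
    simp
  have h2 : dist w z = |Real.log z.im| := by
    rw [UpperHalfPlane.dist_of_re_eq hwre, hwim, Real.log_one, Real.dist_eq, zero_sub, abs_neg]
  linarith [dist_triangle UpperHalfPlane.I w z]

/-- A standard generator as an element of `BS(p,q)`. -/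
def BS.of (p q : ℤ) (x : Gen) : BS p q := PresentedGroup.of x

section Projection

variable {p q : ℤ} (hp : 1 ≤ p) (hpq : p < q)

lemma imPart_eq_scale (g : BS p q) : imPart hp hpq g = (projAff hp hpq g).scale := by
  simp [imPart, projH, AffPlus.onH]

lemma rePart_eq_shift (g : BS p q) : rePart hp hpq g = (projAff hp hpq g).shift := by
  simp [rePart, projH, AffPlus.onH]

lemma imPart_pos (g : BS p q) : 0 < imPart hp hpq g :=
  UpperHalfPlane.im_pos _

lemma log_imPart_mul (g h : BS p q) :
    Real.log (imPart hp hpq (g * h)) =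
      Real.log (imPart hp hpq g) + Real.log (imPart hp hpq h) := by
  rw [← Real.log_mul (imPart_pos hp hpq g).ne' (imPart_pos hp hpq h).ne']
  simp [imPart_eq_scale]

lemma rePart_mul (g h : BS p q) :
    rePart hp hpq (g * h) = imPart hp hpq g * rePart hp hpq h + rePart hp hpq g := by
  simp [imPart_eq_scale, rePart_eq_shift]

lemma log_imPart_one : Real.log (imPart hp hpq 1) = 0 := by
  simp [imPart_eq_scale]

lemma projH_one : projH hp hpq 1 = UpperHalfPlane.I := by
  apply UpperHalfPlane.ext
  simp [projH, AffPlus.onH]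

lemma lift_a {H : Type*} [Group H] {x y : H} (h : x * y ^ p * x⁻¹ = y ^ q) :
    lift x y h (BS.of p q Gen.a) = x :=
  PresentedGroup.toGroup.of _

lemma lift_b {H : Type*} [Group H] {x y : H} (h : x * y ^ p * x⁻¹ = y ^ q) :
    lift x y h (BS.of p q Gen.b) = y :=
  PresentedGroup.toGroup.of _

lemma log_imPart_a : Real.log (imPart hp hpq (BS.of p q Gen.a)) = Real.log ((q : ℝ) / p) := by
  have h : projAff hp hpq (BS.of p q Gen.a) =
      AffPlus.dilation ((q : ℝ) / p) (ratio_pos hp hpq) := lift_a _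
  rw [imPart_eq_scale, h]
  rfl

lemma log_imPart_b : Real.log (imPart hp hpq (BS.of p q Gen.b)) = 0 := by
  have h : projAff hp hpq (BS.of p q Gen.b) = AffPlus.translation 1 := lift_b _
  rw [imPart_eq_scale, h]
  exact Real.log_one

lemma level_a : level (BS.of p q Gen.a) = 1 :=
  congrArg Multiplicative.toAdd (lift_a (by simp))

lemma level_b : level (BS.of p q Gen.b) = 0 :=
  congrArg Multiplicative.toAdd (lift_b (by simp))

/-- Both sides are homomorphisms to the additive reals, so comparing them on `a` and `b` is enough.
-/
lemma log_imPart_eq_level_mul (g : BS p q) :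
    Real.log (imPart hp hpq g) = level g * Real.log ((q : ℝ) / p) := by
  let φ : BS p q →* Multiplicative ℝ :=
    { toFun := fun g => Multiplicative.ofAdd (Real.log (imPart hp hpq g))
      map_one' := by simp [log_imPart_one]
      map_mul' := fun g h => by simp [log_imPart_mul] }
  let ψ : BS p q →* Multiplicative ℝ :=
    { toFun := fun g => Multiplicative.ofAdd (level g * Real.log ((q : ℝ) / p))
      map_one' := by simp [level]
      map_mul' := fun g h => by simp [level, add_mul] }
  have hφψ : φ = ψ := by
    refine PresentedGroup.ext (rels := relators p q) fun x => ?_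
    change Multiplicative.ofAdd (Real.log (imPart hp hpq (BS.of p q x))) =
      Multiplicative.ofAdd (level (BS.of p q x) * Real.log ((q : ℝ) / p))
    cases x
    · rw [log_imPart_a, level_a, Int.cast_one, one_mul]
    · rw [log_imPart_b, level_b, Int.cast_zero, zero_mul]
  exact congrArg Multiplicative.toAdd (DFunLike.congr_fun hφψ g)

end Projection

section RandomWalk

variable {Ω G : Type*} [MeasurableSpace Ω] [Group G] [MeasurableSpace G] {P : Measure Ω}
  {μ : PMF G} {Z : ℕ → Ω → G}

/-- The group operations of `G` are not assumed measurable. But `Measure.map` along a map that is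
not a.e. measurable is zero by convention, whereas the law is a probability measure. -/
lemma IsRandomWalk.aemeasurable_increment (hZ : IsRandomWalk P μ Z) (n : ℕ) :
    AEMeasurable (increment Z n) P := by
  by_contra h
  have hlaw := hZ.law n
  rw [Measure.map_of_not_aemeasurable h] at hlaw
  exact IsProbabilityMeasure.ne_zero μ.toMeasure hlaw.symm

/-- The strong law of large numbers for a function of the increments. -/
lemma IsRandomWalk.strong_law (hZ : IsRandomWalk P μ Z) {f : G → ℝ} (hf : Measurable f)
    (hint : Integrable (fun ω => f (increment Z 0 ω)) P) :
    ∀ᵐ ω ∂P, Tendsto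
      (fun n : ℕ => (∑ i ∈ Finset.range n, f (increment Z i ω)) / n) atTop
      (𝓝 (∫ ω, f (increment Z 0 ω) ∂P)) := by
  refine strong_law_ae_real (fun n ω => f (increment Z n ω)) hint ?_ ?_
  · intro i j hij
    exact (hZ.indep.indepFun hij).comp hf hf
  · intro i
    have hid : IdentDistrib (increment Z i) (increment Z 0) P P :=
      ⟨hZ.aemeasurable_increment i, hZ.aemeasurable_increment 0, by rw [hZ.law, hZ.law]⟩
    exact hid.comp hf

end RandomWalk

/-- Domination by `|y| ≤ 1 + |y|^k`, valid for `k ≥ 1`. -/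
lemma HasFiniteMoment.integrable {Ω : Type*} [MeasurableSpace Ω] {P : Measure Ω}
    [IsFiniteMeasure P] {Y : Ω → ℝ} {k : ℝ} (hY : AEStronglyMeasurable Y P) (hk : 1 ≤ k)
    (h : HasFiniteMoment P Y k) : Integrable Y P := by
  refine ((integrable_const (1 : ℝ)).add h).mono' hY (Eventually.of_forall fun ω => ?_)
  rw [Real.norm_eq_abs, Pi.add_apply]
  rcases le_total |Y ω| 1 with h1 | h1
  · exact h1.trans (le_add_of_nonneg_right (by positivity))
  · exact (Real.self_le_rpow_of_one_le h1 hk).trans (le_add_of_nonneg_left zero_le_one)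

end BaumslagSolitar

open BaumslagSolitar

theorem lemma5p3 {p q : ℤ} (hp : 1 ≤ p) (hpq : p < q)
    {Ω : Type*} [MeasurableSpace Ω] (P : Measure Ω) [IsProbabilityMeasure P]
    (μ : PMF (BaumslagSolitar.BS p q)) (Z : ℕ → Ω → BaumslagSolitar.BS p q)
    (hZ : BaumslagSolitar.IsRandomWalk P μ Z)
    (hA : BaumslagSolitar.HasFiniteMoment P
      (fun ω => Real.log (BaumslagSolitar.imPart hp hpq (BaumslagSolitar.increment Z 0 ω))) 2)
    (hB : ∃ ε : ℝ, 0 < ε ∧ BaumslagSolitar.HasFiniteMoment P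
      (fun ω => Real.log (1 + |BaumslagSolitar.rePart hp hpq (BaumslagSolitar.increment Z 0 ω)|))
      (2 + ε))
    (hdrift : BaumslagSolitar.verticalDrift P Z = 0) :
    ∀ᵐ ω ∂P, Tendsto
      (fun n : ℕ => dist (BaumslagSolitar.projH hp hpq (Z 0 ω))
        (BaumslagSolitar.projH hp hpq (Z n ω)) / (n : ℝ))
      atTop (𝓝 0) := by
  obtain ⟨ε, hε, hB⟩ := hB
  let fA : BS p q → ℝ := fun g => Real.log (imPart hp hpq g)
  let fB : BS p q → ℝ := fun g => Real.log (1 + |rePart hp hpq g|)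
  have hfA : Measurable fA := Measurable.of_discrete
  have hfB : Measurable fB := Measurable.of_discrete
  have hX := hZ.aemeasurable_increment 0
  have hintA : Integrable (fun ω => fA (increment Z 0 ω)) P :=
    HasFiniteMoment.integrable (hfA.comp_aemeasurable hX).aestronglyMeasurable
      one_le_two hA
  have hintB : Integrable (fun ω => fB (increment Z 0 ω)) P :=
    HasFiniteMoment.integrable (hfB.comp_aemeasurable hX).aestronglyMeasurable
      (by linarith) hB
  have hmean : ∫ ω, fA (increment Z 0 ω) ∂P = 0 := by
    simp only [fA, log_imPart_eq_level_mul]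
    rw [integral_mul_const]
    exact mul_eq_zero_of_left hdrift _
  filter_upwards [hZ.start, hZ.strong_law hfA hintA, hZ.strong_law hfB hintB]
    with ω h0 hSA hSB
  rw [hmean] at hSA
  have hstep : ∀ n, Z (n + 1) ω = Z n ω * increment Z n ω := fun n => by simp [increment]
  have hsum : ∀ n, ∑ i ∈ Finset.range n, fA (increment Z i ω) = fA (Z n ω) := by
    intro n
    induction n with
    | zero => simp [fA, h0, log_imPart_one]
    | succ n ih => rw [Finset.sum_range_succ, ih, hstep]; exact (log_imPart_mul hp hpq _ _).symm
  simp only [hsum] at hSA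
  have hshift : Tendsto (fun n : ℕ => fB (Z n ω) / n) atTop (𝓝 0) := by
    refine tendsto_log_div_of_le_add_exp (u := fun n => 1 + |rePart hp hpq (Z n ω)|)
      (a := fun n => fA (Z n ω) + fB (increment Z n ω)) (fun n => by simp) (fun n => ?_) ?_
    -- Here `exp (a n) = A_{Z_n} (1 + |B_{X_{n+1}}|)`, which dominates the added term `A_{Z_n}
    -- |B_{X_{n+1}}|`.
    · have hpos := imPart_pos hp hpq (Z n ω)
      rw [Real.exp_add, Real.exp_log hpos, Real.exp_log (by positivity), hstep, rePart_mul]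
      have habs := abs_add_le (imPart hp hpq (Z n ω) * rePart hp hpq (increment Z n ω))
        (rePart hp hpq (Z n ω))
      rw [abs_mul, abs_of_pos hpos] at habs
      linarith
    · simpa only [add_div, add_zero] using hSA.add (tendsto_div_of_tendsto_sum_div hSB)
  have hbound : Tendsto (fun n : ℕ => |fA (Z n ω) / n| + 2 * (fB (Z n ω) / n)) atTop (𝓝 0) := by
    simpa using hSA.abs.add (hshift.const_mul 2)
  refine squeeze_zero (fun n => by positivity) (fun n => ?_) hbound
  rw [h0, projH_one]
  refine (div_le_div_of_nonneg_right (dist_I_le _) n.cast_nonneg).trans_eq ?_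
  rw [add_div, abs_div, Nat.abs_cast, mul_div_assoc]
  rfl
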